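/- \textbf{Theorem (Early Stopping Bound).} Let $X=[x_1,\dots,x_d]\in\mathbb R^{n\times d}$ with spectral norm $\|X\|$, let $1\le k\le d$, $\alpha\in(0,1)$, $\delta\in(0,1]$, and let $y,y^\delta\in\mathbb R^n$ with $\|y^\delta-y\|_2\le\delta$. Write $M^\dagger$ for the Moore–Penrose pseudo-inverse, $X_S$ for the submatrix of columns with index in $S$, $w_S$ for the restriction of $w$ to $S$, and let $$\|w\|_k^{sp}=\min\Big\{\sum_{|I|\le k}\|v_I\|_2:\ \operatorname{supp}(v_I)\subseteq I,\ \sum_{|I|\le k} v_I=w\Big\},\qquad F(w)=\tfrac{1-\alpha}{2}\big(\|w\|_k^{sp}\big)^2,\qquad P(v)=\operatorname{prox}_{\alpha^{-1}F}\!\big(-\alpha^{-1}X^\top v\big),$$ where $\operatorname{prox}_h(z)=\arg\min_w h(w)+\frac12\|w-z\|_2^2$. The IRKSN iterates $\hat w_t$ (accelerated dual gradient descent for $\min F(w)+\frac\alpha2\|w\|_2^2$ subject to $Xw=y^\delta$) are, for a starting point $v_0=z_{-1}\in\mathbb R^n$, $\theta_0=1$ and $\gamma=\alpha\|X\|^{-2}$,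 $$z_t=v_t+\gamma\big(X P(v_t)-y^\delta\big),\quad \hat w_t=P(z_t),\quad \theta_{t+1}=\frac{1+\sqrt{1+4\theta_t^2}}2,\quad v_{t+1}=z_t+\frac{\theta_t-1}{\theta_{t+1}}(z_t-z_{t-1})\qquad(t\ge0).$$ Assume that $w^*\in\mathbb R^d$ satisfies: (i) $w^*$ has support $S=\{i: w^*_i\neq0\}$ with $|S|=k$, $Xw^*=y$, and $w^*_S$ has the least $\ell_2$ norm among all $z$ with $X_Sz=y$; (ii) $\max_{\ell\notin S}|\langle X_S^\dagger x_\ell,w^*_S\rangle|<\min_{j\in S}|\langle X_S^\dagger x_j,w^*_S\rangle|$; (iii) $\alpha<\eta/\|w^*\|_\infty$ with $\eta=\min_{j\in S}|\langle (X_SX_S^\top)^\dagger y,x_j\rangle|-\max_{\ell\notin S}|\langle (X_SX_S^\top)^\dagger y,x_\ell\rangle|$ (conditions (ii) and (iii) being void when $k=d$). Put $$a=4\|X\|^{-1},\qquad b=\frac{2\|X\|\,\|v_0+(X_S^\top)^\dagger w^*_S\|_2}{\alpha},$$ so that $b=2\|X\|\,\|(X_S^\top)^\dagger w^*_S\|_2/\alpha$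 for the initialization $v_0=0$. Then for every integer $t\ge2$, $$\|\hat w_t-w^*\|_2\le a\,t\,\delta+b\,t^{-1},$$ and for every $c>0$, with $t_\delta=\lceil c\,\delta^{-1/2}\rceil$, $$\|\hat w_{t_\delta}-w^*\|_2\le\big(a(c+1)+b\,c^{-1}\big)\delta^{1/2}.$$ -/

import Mathlib

namespace IRKSN

noncomputable section

/-! ### The Moore-Penrose pseudo-inverse of a real matrix -/

/-- `P` satisfies the four Penrose equations for the real matrix `A`. -/
structure IsMoorePenrose {m n : Type*} [Fintype m] [Fintype n]
    (A : Matrix m n ℝ) (P : Matrix n m ℝ) : Prop where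
  mul_mul_left : A * P * A = A
  mul_mul_right : P * A * P = P
  symm_left : (A * P).transpose = A * P
  symm_right : (P * A).transpose = P * A

/-- A real symmetric matrix has a symmetric pseudo-inverse commuting with it. -/
theorem exists_symm_pinv {n : Type*} [Fintype n] [DecidableEq n]
    (H : Matrix n n ℝ) (hH : H.IsHermitian) :
    ∃ G : Matrix n n ℝ, H * G * H = H ∧ G * H * G = G ∧ H * G = G * H ∧ G.transpose = G := by
  set U : Matrix n n ℝ := (hH.eigenvectorUnitary : Matrix n n ℝ) with hU
  set e : n → ℝ := hH.eigenvalues with he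
  have hUU : star U * U = 1 := by
    rw [hU]; exact Unitary.coe_star_mul_self hH.eigenvectorUnitary
  have hspec : H = U * Matrix.diagonal e * star U := by
    have h := hH.spectral_theorem
    rw [Unitary.conjStarAlgAut_apply] at h
    simpa using h
  have hmul : ∀ a b : n → ℝ, (U * Matrix.diagonal a * star U) * (U * Matrix.diagonal b * star U)
      = U * Matrix.diagonal (fun i => a i * b i) * star U := by
    intro a b
    calc (U * Matrix.diagonal a * star U) * (U * Matrix.diagonal b * star U)
        = U * Matrix.diagonal a * (star U * U) * Matrix.diagonal b * star U := by
          simp only [Matrix.mul_assoc]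
      _ = U * (Matrix.diagonal a * Matrix.diagonal b) * star U := by
          rw [hUU, Matrix.mul_one, Matrix.mul_assoc U]
      _ = _ := by rw [Matrix.diagonal_mul_diagonal]
  refine ⟨U * Matrix.diagonal (fun i => (e i)⁻¹) * star U, ?_, ?_, ?_, ?_⟩
  · rw [hspec, hmul, hmul]
    congr 3; funext i
    exact mul_inv_mul_cancel (e i)
  · rw [hspec, hmul, hmul]
    congr 3; funext i
    simpa using mul_inv_mul_cancel (e i)⁻¹
  · rw [hspec, hmul, hmul]
    congr 3; funext i
    exact mul_comm _ _
  · simp [Matrix.star_eq_conjTranspose, Matrix.conjTranspose_eq_transpose_of_trivial,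
      Matrix.transpose_mul, Matrix.mul_assoc]

theorem exists_isMoorePenrose {m n : Type*} [Fintype m] [Fintype n]
    (A : Matrix m n ℝ) : ∃ P : Matrix n m ℝ, IsMoorePenrose A P := by
  classical
  have hH : (A.transpose * A).IsHermitian := by
    rw [Matrix.IsHermitian, Matrix.conjTranspose_eq_transpose_of_trivial,
      Matrix.transpose_mul, Matrix.transpose_transpose]
  obtain ⟨G, h1, h2, h3, h4⟩ := exists_symm_pinv (A.transpose * A) hH
  have hcancel : ∀ B : Matrix n n ℝ, A.transpose * A * B = 0 → A * B = 0 := by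
    intro B hB
    have := (Matrix.conjTranspose_mul_self_mul_eq_zero A B).1
    rw [Matrix.conjTranspose_eq_transpose_of_trivial] at this
    exact this hB
  refine ⟨G * A.transpose, ?_, ?_, ?_, ?_⟩
  · have h : A * (G * (A.transpose * A) - 1) = 0 := by
      apply hcancel
      rw [Matrix.mul_sub, Matrix.mul_one, ← Matrix.mul_assoc, h1, sub_self]
    rw [Matrix.mul_sub, Matrix.mul_one, sub_eq_zero] at h
    simpa only [Matrix.mul_assoc] using h
  · calc G * A.transpose * A * (G * A.transpose)
        = (G * (A.transpose * A) * G) * A.transpose := by simp only [Matrix.mul_assoc]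
      _ = _ := by rw [h2]
  · simp only [Matrix.transpose_mul, Matrix.transpose_transpose, h4, Matrix.mul_assoc]
  · have : (G * (A.transpose * A)).transpose = G * (A.transpose * A) := by
      rw [Matrix.transpose_mul, h4, Matrix.transpose_mul, Matrix.transpose_transpose, h3]
    simpa only [Matrix.mul_assoc] using this

/-- The Moore-Penrose pseudo-inverse `A†`. -/
def pinv {m n : Type*} [Fintype m] [Fintype n] (A : Matrix m n ℝ) : Matrix n m ℝ :=
  Classical.choose (exists_isMoorePenrose A)

theorem pinv_spec {m n : Type*} [Fintype m] [Fintype n] (A : Matrix m n ℝ) :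
    IsMoorePenrose A (pinv A) :=
  Classical.choose_spec (exists_isMoorePenrose A)

/-- The four Penrose equations have at most one solution, so `pinv` is determined by them. -/
theorem IsMoorePenrose.eq_pinv {m n : Type*} [Fintype m] [Fintype n] {A : Matrix m n ℝ}
    {P : Matrix n m ℝ} (hP : IsMoorePenrose A P) : P = pinv A := by
  set Q := pinv A with hQ
  have hq : IsMoorePenrose A Q := pinv_spec A
  have hAP : A * P = A * Q := by
    have h : (A * Q * (A * P)).transpose = A * P * (A * Q) := by
      rw [Matrix.transpose_mul, hP.symm_left, hq.symm_left]
    rw [← Matrix.mul_assoc, hq.mul_mul_left, hP.symm_left, ← Matrix.mul_assoc,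
      hP.mul_mul_left] at h
    exact h
  have hPA : P * A = Q * A := by
    have h : (P * A * (Q * A)).transpose = Q * A * (P * A) := by
      rw [Matrix.transpose_mul, hP.symm_right, hq.symm_right]
    rw [Matrix.mul_assoc, ← Matrix.mul_assoc A, hq.mul_mul_left, hP.symm_right,
      Matrix.mul_assoc, ← Matrix.mul_assoc A, hP.mul_mul_left] at h
    exact h
  calc P = P * (A * P) := by rw [← Matrix.mul_assoc, hP.mul_mul_right]
    _ = Q * A * Q := by rw [hAP, ← Matrix.mul_assoc, hPA]
    _ = Q := hq.mul_mul_right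

/-! ### Matrices and vectors -/

/-- The action `A x` of a matrix on Euclidean vectors. -/
def act {m n : Type*} [Fintype m] [Fintype n]
    (A : Matrix m n ℝ) (x : EuclideanSpace ℝ n) : EuclideanSpace ℝ m :=
  WithLp.toLp 2 (A.mulVec x.ofLp)

/-- The spectral norm `‖A‖`: the operator norm between Euclidean spaces. -/
def opNorm {m n : Type*} [Fintype m] [Fintype n] [DecidableEq n] (A : Matrix m n ℝ) : ℝ :=
  ‖LinearMap.toContinuousLinearMap (Matrix.toEuclideanLin A)‖

/-- The submatrix `X_S` formed by the columns with index in `S`. -/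
def colsOn {n d : ℕ} (X : Matrix (Fin n) (Fin d) ℝ) (S : Finset (Fin d)) :
    Matrix (Fin n) S ℝ :=
  X.submatrix id Subtype.val

/-- The restriction `w_S` of a vector to the coordinates in `S`. -/
def restr {d : ℕ} (S : Finset (Fin d)) (w : EuclideanSpace ℝ (Fin d)) : EuclideanSpace ℝ S :=
  WithLp.toLp 2 (fun i => w i.val)

/-- The `j`-th column `x_j` of `X`. -/
def column {n d : ℕ} (X : Matrix (Fin n) (Fin d) ℝ) (j : Fin d) : EuclideanSpace ℝ (Fin n) :=
  WithLp.toLp 2 (fun i => X i j)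

/-- The norm `‖w‖_∞`, the largest modulus of a coordinate. -/
def linftyNorm {d : ℕ} (w : EuclideanSpace ℝ (Fin d)) : ℝ := ‖w.ofLp‖

/-! ### The `k`-support norm and the proximal operator -/

/-- The `k`-support norm: the least value of `∑_I ‖v_I‖₂` over all decompositions `w = ∑_I v_I`,
where `I` runs over the index sets of cardinality at most `k` and `supp v_I ⊆ I`. -/
def kSupportNorm {d : ℕ} (k : ℕ) (w : EuclideanSpace ℝ (Fin d)) : ℝ :=
  sInf {r : ℝ | ∃ v : {I : Finset (Fin d) // I.card ≤ k} → EuclideanSpace ℝ (Fin d),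
    (∀ I, ∀ i, i ∉ I.val → v I i = 0) ∧ ∑ I, v I = w ∧ r = ∑ I, ‖v I‖}

/-- The proximal operator `prox_h(z) = argmin_w h(w) + ½‖w - z‖₂²`. -/
def prox {d : ℕ} (h : EuclideanSpace ℝ (Fin d) → ℝ) (z : EuclideanSpace ℝ (Fin d)) :
    EuclideanSpace ℝ (Fin d) :=
  Classical.epsilon fun w => ∀ u, h w + 1 / 2 * ‖w - z‖ ^ 2 ≤ h u + 1 / 2 * ‖u - z‖ ^ 2

/-! ### The algorithm -/

/-- `F(w) = (1-α)/2 · (‖w‖_k^sp)²`, the part of the regularizer other than `α/2 · ‖w‖₂²`. -/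
def regF {d : ℕ} (k : ℕ) (α : ℝ) (w : EuclideanSpace ℝ (Fin d)) : ℝ :=
  (1 - α) / 2 * kSupportNorm k w ^ 2

/-- The map `v ↦ prox_{α⁻¹F}(-α⁻¹ Xᵀ v)` from dual to primal variables. -/
def primal {n d : ℕ} (X : Matrix (Fin n) (Fin d) ℝ) (k : ℕ) (α : ℝ)
    (v : EuclideanSpace ℝ (Fin n)) : EuclideanSpace ℝ (Fin d) :=
  prox (fun w => α⁻¹ * regF k α w) (-(α⁻¹ • act X.transpose v))

/-- `θ_0 = 1`, `θ_{t+1} = (1 + √(1 + 4θ_t²)) / 2`. -/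
def theta : ℕ → ℝ
  | 0 => 1
  | t + 1 => (1 + √(1 + 4 * theta t ^ 2)) / 2

/-- `v ↦ v + γ (X r - y^δ)` with `r = prox_{α⁻¹F}(-α⁻¹ Xᵀ v)` and `γ = α‖X‖⁻²`. -/
def dualStep {n d : ℕ} (X : Matrix (Fin n) (Fin d) ℝ) (k : ℕ) (α : ℝ)
    (yδ v : EuclideanSpace ℝ (Fin n)) : EuclideanSpace ℝ (Fin n) :=
  v + (α * (opNorm X ^ 2)⁻¹) • (act X (primal X k α v) - yδ)

/-- The pair `(z_{t-1}, v_t)` at the start of iteration `t`, from `z_{-1} = v_0`. -/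
def dualState {n d : ℕ} (X : Matrix (Fin n) (Fin d) ℝ) (k : ℕ) (α : ℝ)
    (yδ v₀ : EuclideanSpace ℝ (Fin n)) :
    ℕ → EuclideanSpace ℝ (Fin n) × EuclideanSpace ℝ (Fin n)
  | 0 => (v₀, v₀)
  | t + 1 =>
    let s := dualState X k α yδ v₀ t
    let z := dualStep X k α yδ s.2
    (z, z + ((theta t - 1) / theta (t + 1)) • (z - s.1))

/-- `z_t = v_t + γ (X r_t - y^δ)`. -/
def dualIterate {n d : ℕ} (X : Matrix (Fin n) (Fin d) ℝ) (k : ℕ) (α : ℝ)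
    (yδ v₀ : EuclideanSpace ℝ (Fin n)) (t : ℕ) : EuclideanSpace ℝ (Fin n) :=
  dualStep X k α yδ (dualState X k α yδ v₀ t).2

/-- The IRKSN iterate `ŵ_t = prox_{α⁻¹F}(-α⁻¹ Xᵀ z_t)`. -/
def iterate {n d : ℕ} (X : Matrix (Fin n) (Fin d) ℝ) (k : ℕ) (α : ℝ)
    (yδ v₀ : EuclideanSpace ℝ (Fin n)) (t : ℕ) : EuclideanSpace ℝ (Fin d) :=
  primal X k α (dualIterate X k α yδ v₀ t)

end

end IRKSN

namespace IRKSN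

open Matrix

/-! ### Matrices acting on Euclidean vectors -/

/-! Let `J = F + α/2 ‖·‖²`. The iteration is Nesterov's method for the dual function `D(v) = J*(-Xᵀ
v) + ⟨y, v⟩`, whose gradient is `y - X P(v)` and is Lipschitz with constant `‖X‖²/α = 1/γ`. Noise in
the data only adds the constant error `yδ - y` to that gradient.

Optimality of `w`. With `q = (X_Sᵀ)† w_S`, minimality of `‖w_S‖` makes `Xᵀ q` equal to `w` on `S`.
Write `Xᵀ q = (1 - α) u + α w`. The bound on `α` makes the entries of `u` off `S` no larger in
modulus than those of `w` on `S`, so the `k` largest entries of `u` have norm at most `‖w‖`, and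
duality for the `k`-support norm makes `(1 - α) u` a subgradient of `F` at `w`
(`regF_add_inner_le`). Hence `Xᵀ q ∈ ∂J(w)`, and `-q` solves the noiseless dual
(`isDualCertificate_pinv`).

Rate. Strong convexity of `J` bounds `α/2 ‖P(z) - w‖²` by the dual gap at `z`
(`norm_sub_sq_le_dualObjective_sub`). The usual energy, scaled gap plus squared distance to `-q`,
grows in step `t` by at most `θ_t δ` times the new distance (`accelerated_step`). As `θ_0 + ⋯ + θ_t
= θ_t²`, this gives `θ_t² · gap ≤ (R + 2γδθ_t²)²/(2γ)` with `R = ‖v₀ + q‖` (`energy_bound`). Taking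
roots leaves a term of order `1/θ_t` and one of order `δ θ_t`, and `θ_t` is comparable to `t`. -/

theorem inner_eq_dotProduct {ι : Type*} [Fintype ι] (u v : EuclideanSpace ℝ ι) :
    inner ℝ u v = u.ofLp ⬝ᵥ v.ofLp := by
  rw [EuclideanSpace.inner_eq_star_dotProduct, star_trivial, dotProduct_comm]

theorem inner_act_transpose {m n : Type*} [Fintype m] [Fintype n] (A : Matrix m n ℝ)
    (v : EuclideanSpace ℝ m) (u : EuclideanSpace ℝ n) :
    inner ℝ (act A.transpose v) u = inner ℝ v (act A u) := by
  simp only [inner_eq_dotProduct, act]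
  rw [mulVec_transpose, dotProduct_mulVec]

theorem act_mul {l m n : Type*} [Fintype l] [Fintype m] [Fintype n] (A : Matrix l m ℝ)
    (B : Matrix m n ℝ) (x : EuclideanSpace ℝ n) : act (A * B) x = act A (act B x) := by
  simp [act, mulVec_mulVec]

theorem act_sub {m n : Type*} [Fintype m] [Fintype n] (A : Matrix m n ℝ)
    (u v : EuclideanSpace ℝ n) : act A (u - v) = act A u - act A v := by
  simp [act, mulVec_sub]

theorem norm_act_le {m n : Type*} [Fintype m] [Fintype n] [DecidableEq n] (A : Matrix m n ℝ)
    (x : EuclideanSpace ℝ n) : ‖act A x‖ ≤ opNorm A * ‖x‖ :=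
  (LinearMap.toContinuousLinearMap (Matrix.toEuclideanLin A)).le_opNorm x

theorem opNorm_nonneg {m n : Type*} [Fintype m] [Fintype n] [DecidableEq n]
    (A : Matrix m n ℝ) : 0 ≤ opNorm A :=
  norm_nonneg _

theorem act_transpose_apply {n d : ℕ} (X : Matrix (Fin n) (Fin d) ℝ)
    (v : EuclideanSpace ℝ (Fin n)) (j : Fin d) :
    act X.transpose v j = inner ℝ v (column X j) := by
  rw [inner_eq_dotProduct, dotProduct_comm]
  rfl

theorem act_colsOn_transpose {n d : ℕ} (X : Matrix (Fin n) (Fin d) ℝ) (S : Finset (Fin d))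
    (v : EuclideanSpace ℝ (Fin n)) :
    act (colsOn X S).transpose v = restr S (act X.transpose v) :=
  rfl

theorem act_colsOn_restr {n d : ℕ} (X : Matrix (Fin n) (Fin d) ℝ) (S : Finset (Fin d))
    (w : EuclideanSpace ℝ (Fin d)) (hw : ∀ i, i ∉ S → w i = 0) :
    act (colsOn X S) (restr S w) = act X w := by
  ext i
  change ∑ j : S, X i j * w j = ∑ j, X i j * w j
  rw [Finset.sum_coe_sort S (fun j => X i j * w j)]
  exact Finset.sum_subset (Finset.subset_univ S) fun j _ hj => by rw [hw j hj, mul_zero]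

/-! ### Pseudo-inverses -/

/-- A least-norm solution of `A x = y` lies in the row space of `A`. -/
theorem act_transpose_pinv_transpose_of_least_norm {m n : Type*} [Fintype m] [Fintype n]
    (A : Matrix m n ℝ) (x : EuclideanSpace ℝ n)
    (hx : ∀ z, act A z = act A x → ‖x‖ ≤ ‖z‖) :
    act A.transpose (act (pinv A.transpose) x) = x := by
  obtain ⟨h1, -, h3, -⟩ := pinv_spec A.transpose
  set B := pinv A.transpose
  set z := act (A.transpose * B) x with hz
  have hAz : act A z = act A x := by
    rw [hz, ← act_mul]
    congr 1
    rw [← h3, ← transpose_inj, transpose_mul, transpose_transpose, h1]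
  have hzz : act (A.transpose * B) z = z := by
    rw [hz, ← act_mul, ← Matrix.mul_assoc, h1]
  -- `z` is the orthogonal projection of `x` onto the row space, so `‖x - z‖² = ‖x‖² - ‖z‖²`, which
  -- minimality makes nonpositive.
  have hin : inner ℝ x z = ‖z‖ ^ 2 := by
    calc inner ℝ x z = inner ℝ x (act (A.transpose * B) z) := by rw [hzz]
      _ = inner ℝ z z := by rw [← inner_act_transpose, h3]
      _ = ‖z‖ ^ 2 := real_inner_self_eq_norm_sq z
  have hle := hx z hAz
  have h0 : ‖x - z‖ ^ 2 ≤ 0 := by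
    rw [norm_sub_sq_real, hin]
    nlinarith [norm_nonneg x, norm_nonneg z]
  have : x - z = 0 := by
    rw [← norm_eq_zero]
    exact pow_eq_zero_iff (two_ne_zero) |>.1 (le_antisymm h0 (sq_nonneg _))
  rw [← act_mul]
  exact (sub_eq_zero.1 this).symm

/-- With `B = (Aᵀ)†`, the matrix `B Bᵀ` satisfies the Penrose equations for `A Aᵀ`, and `B Bᵀ A = B
Aᵀ B = B`. This identifies `(X_S X_Sᵀ)† y` in the condition on `α` with the certificate `(X_Sᵀ)†
w_S`. -/
theorem pinv_mul_transpose_mul {m n : Type*} [Fintype m] [Fintype n] (A : Matrix m n ℝ) :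
    pinv (A * A.transpose) * A = pinv A.transpose := by
  obtain ⟨h1, h2, h3, h4⟩ := pinv_spec A.transpose
  set B := pinv A.transpose
  have e1 : A * B.transpose = B * A.transpose := by
    rw [← h4, transpose_mul, transpose_transpose]
  have e2 : B.transpose * A = A.transpose * B := by
    rw [← h3, transpose_mul, transpose_transpose]
  have e3 : B * A.transpose * A = A := by
    rw [← e1, ← transpose_inj, transpose_mul, transpose_mul, transpose_transpose,
      ← Matrix.mul_assoc, h1]
  have e4 : A * A.transpose * B = A := by
    rw [Matrix.mul_assoc, ← e2, ← Matrix.mul_assoc, e1, e3]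
  have e5 : B.transpose * B * A.transpose = B.transpose := by
    rw [Matrix.mul_assoc, ← e1, ← transpose_inj, transpose_mul, transpose_mul,
      transpose_transpose, h2]
  have p1 : A * A.transpose * (B * B.transpose) = B * A.transpose := by
    rw [← Matrix.mul_assoc, e4, e1]
  have p2 : B * B.transpose * (A * A.transpose) = B * A.transpose := by
    rw [Matrix.mul_assoc, ← Matrix.mul_assoc B.transpose, e2, Matrix.mul_assoc A.transpose,
      ← Matrix.mul_assoc, ← Matrix.mul_assoc, h2]
  have hMP : IsMoorePenrose (A * A.transpose) (B * B.transpose) := by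
    refine ⟨?_, ?_, ?_, ?_⟩
    · rw [p1, ← Matrix.mul_assoc, e3]
    · rw [p2, ← Matrix.mul_assoc, h2]
    · rw [p1, h4]
    · rw [p2, h4]
  rw [← hMP.eq_pinv, Matrix.mul_assoc, e2, ← Matrix.mul_assoc, h2]

/-! ### The `k`-support norm -/

section KSupport

variable {d : ℕ} {k : ℕ}

theorem kSupportNorm_le_sum {w : EuclideanSpace ℝ (Fin d)}
    (v : {I : Finset (Fin d) // I.card ≤ k} → EuclideanSpace ℝ (Fin d))
    (hv : ∀ I, ∀ i, i ∉ I.val → v I i = 0) (hw : ∑ I, v I = w) :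
    kSupportNorm k w ≤ ∑ I, ‖v I‖ := by
  refine csInf_le ⟨0, ?_⟩ ⟨v, hv, hw, rfl⟩
  rintro r ⟨v, -, -, rfl⟩
  exact Finset.sum_nonneg fun _ _ => norm_nonneg _

theorem kSupportNorm_nonneg (w : EuclideanSpace ℝ (Fin d)) : 0 ≤ kSupportNorm k w := by
  refine Real.sInf_nonneg ?_
  rintro r ⟨v, -, -, rfl⟩
  exact Finset.sum_nonneg fun _ _ => norm_nonneg _

/-- Singletons are admissible index sets, so the infimum defining the norm is over a nonempty set
and can be bounded below. -/
theorem exists_kSupport_decomposition (hk : 1 ≤ k) (w : EuclideanSpace ℝ (Fin d)) :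
    ∃ v : {I : Finset (Fin d) // I.card ≤ k} → EuclideanSpace ℝ (Fin d),
      (∀ I, ∀ i, i ∉ I.val → v I i = 0) ∧ ∑ I, v I = w := by
  let s : Fin d → {I : Finset (Fin d) // I.card ≤ k} := fun i => ⟨{i}, by simpa using hk⟩
  refine ⟨fun I => ∑ j, if I = s j then EuclideanSpace.single j (w j) else 0, ?_, ?_⟩
  · intro I i hi
    simp only [WithLp.ofLp_sum, Finset.sum_apply]
    refine Finset.sum_eq_zero fun j _ => ?_
    split_ifs with h
    · have hij : i ≠ j := by
        rintro rfl
        exact hi (by rw [h]; simp [s])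
      simp [hij]
    · rfl
  · rw [Finset.sum_comm]
    simp only [Finset.sum_ite_eq', Finset.mem_univ, if_true]
    ext i
    simp only [WithLp.ofLp_sum, Finset.sum_apply, PiLp.single_apply]
    simp

theorem le_kSupportNorm (hk : 1 ≤ k) {w : EuclideanSpace ℝ (Fin d)} {r : ℝ}
    (h : ∀ v : {I : Finset (Fin d) // I.card ≤ k} → EuclideanSpace ℝ (Fin d),
      (∀ I, ∀ i, i ∉ I.val → v I i = 0) → ∑ I, v I = w → r ≤ ∑ I, ‖v I‖) :
    r ≤ kSupportNorm k w := by
  obtain ⟨v, hv, hw⟩ := exists_kSupport_decomposition hk w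
  refine le_csInf ⟨_, v, hv, hw, rfl⟩ ?_
  rintro _ ⟨v, hv, hw, rfl⟩
  exact h v hv hw

theorem kSupportNorm_add_le (hk : 1 ≤ k) (x y : EuclideanSpace ℝ (Fin d)) :
    kSupportNorm k (x + y) ≤ kSupportNorm k x + kSupportNorm k y := by
  rw [← sub_le_iff_le_add]
  refine le_kSupportNorm hk fun v hv hx => ?_
  rw [sub_le_comm]
  refine le_kSupportNorm hk fun u hu hy => ?_
  rw [sub_le_iff_le_add', ← Finset.sum_add_distrib]
  refine (kSupportNorm_le_sum (fun I => v I + u I) (fun I i hi => ?_) ?_).trans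
    (Finset.sum_le_sum fun I _ => norm_add_le _ _)
  · simp [hv I i hi, hu I i hi]
  · rw [Finset.sum_add_distrib, hx, hy]

theorem kSupportNorm_smul_le (hk : 1 ≤ k) {c : ℝ} (hc : 0 ≤ c) (x : EuclideanSpace ℝ (Fin d)) :
    kSupportNorm k (c • x) ≤ c * kSupportNorm k x := by
  have key : ∀ v : {I : Finset (Fin d) // I.card ≤ k} → EuclideanSpace ℝ (Fin d),
      (∀ I, ∀ i, i ∉ I.val → v I i = 0) → ∑ I, v I = x →
      kSupportNorm k (c • x) ≤ c * ∑ I, ‖v I‖ := by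
    intro v hv hx
    refine (kSupportNorm_le_sum (fun I => c • v I) (fun I i hi => ?_) ?_).trans_eq ?_
    · simp [hv I i hi]
    · rw [← Finset.smul_sum, hx]
    · simp [Finset.mul_sum, norm_smul, abs_of_nonneg hc]
  rcases hc.eq_or_lt with rfl | hc'
  · obtain ⟨v, hv, hx⟩ := exists_kSupport_decomposition hk x
    simpa using key v hv hx
  · rw [← div_le_iff₀' hc']
    refine le_kSupportNorm hk fun v hv hx => ?_
    rw [div_le_iff₀' hc']
    exact key v hv hx

theorem kSupportNorm_le_norm {S : Finset (Fin d)} (hS : S.card ≤ k)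
    {w : EuclideanSpace ℝ (Fin d)} (hw : ∀ i, i ∉ S → w i = 0) : kSupportNorm k w ≤ ‖w‖ := by
  refine (kSupportNorm_le_sum (fun I => if I = ⟨S, hS⟩ then w else 0) (fun I i hi => ?_)
    ?_).trans_eq ?_
  · dsimp only
    split_ifs with h
    · subst h
      exact hw i hi
    · rfl
  · simp
  · simp [apply_ite norm]

/-- Hölder's inequality for the `k`-support norm and its dual norm. -/
theorem inner_le_mul_kSupportNorm (hk : 1 ≤ k) {u : EuclideanSpace ℝ (Fin d)} {M : ℝ}
    (hM : 0 ≤ M) (hu : ∀ I : Finset (Fin d), I.card ≤ k → ∑ i ∈ I, u i ^ 2 ≤ M ^ 2)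
    (x : EuclideanSpace ℝ (Fin d)) : inner ℝ u x ≤ M * kSupportNorm k x := by
  have key : ∀ v : {I : Finset (Fin d) // I.card ≤ k} → EuclideanSpace ℝ (Fin d),
      (∀ I, ∀ i, i ∉ I.val → v I i = 0) → ∑ I, v I = x → inner ℝ u x ≤ M * ∑ I, ‖v I‖ := by
    intro v hv hx
    rw [← hx, inner_sum, Finset.mul_sum]
    refine Finset.sum_le_sum fun I _ => ?_
    have h1 : inner ℝ u (v I) = ∑ i ∈ I.val, u i * v I i := by
      rw [inner_eq_dotProduct, dotProduct]
      exact (Finset.sum_subset (Finset.subset_univ _)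
        fun i _ hi => by rw [hv I i hi, mul_zero]).symm
    have h2 : ∑ i ∈ I.val, v I i ^ 2 = ‖v I‖ ^ 2 := by
      rw [EuclideanSpace.real_norm_sq_eq]
      exact Finset.sum_subset (Finset.subset_univ _)
        fun i _ hi => by rw [hv I i hi]; norm_num
    rw [h1]
    refine abs_le_of_sq_le_sq' ?_ (by positivity) |>.2
    calc (∑ i ∈ I.val, u i * v I i) ^ 2
        ≤ (∑ i ∈ I.val, u i ^ 2) * ∑ i ∈ I.val, v I i ^ 2 :=
          Finset.sum_mul_sq_le_sq_mul_sq _ _ _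
      _ ≤ M ^ 2 * ‖v I‖ ^ 2 := by
          rw [h2]
          exact mul_le_mul_of_nonneg_right (hu I.val I.2) (sq_nonneg _)
      _ = (M * ‖v I‖) ^ 2 := by ring
  rcases hM.eq_or_lt with rfl | hM'
  · obtain ⟨v, hv, hx⟩ := exists_kSupport_decomposition hk x
    simpa using key v hv hx
  · rw [← div_le_iff₀' hM']
    refine le_kSupportNorm hk fun v hv hx => ?_
    rw [div_le_iff₀' hM']
    exact key v hv hx

/-- A vector that agrees with `w` on its support `S` and is dominated there by the smallest
entry of `w` has the same `ℓ₂` norm of its `|S|` largest entries as `w`. -/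
theorem sum_sq_le_norm_sq {S : Finset (Fin d)} {u w : EuclideanSpace ℝ (Fin d)}
    (huS : ∀ i ∈ S, u i = w i) (hu : ∀ l, l ∉ S → ∀ j ∈ S, |u l| ≤ |w j|)
    (I : Finset (Fin d)) (hI : I.card ≤ S.card) : ∑ i ∈ I, u i ^ 2 ≤ ‖w‖ ^ 2 := by
  have hcard : (I \ S).card ≤ (S \ I).card := by
    have h1 := Finset.card_sdiff_add_card_inter I S
    have h2 := Finset.card_sdiff_add_card_inter S I
    rw [Finset.inter_comm] at h2
    omega
  have hsum : ∑ i ∈ I \ S, u i ^ 2 ≤ ∑ i ∈ S \ I, w i ^ 2 := by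
    -- An injection of `I \ S` into `S \ I` exchanges each entry of `u` off `S` for an entry of `w`
    -- at least as large in modulus.
    obtain ⟨T, hTS, hTc⟩ := Finset.exists_subset_card_eq hcard
    let e := Finset.equivOfCardEq hTc.symm
    calc ∑ i ∈ I \ S, u i ^ 2
        = ∑ i : (I \ S : Finset (Fin d)), u i ^ 2 :=
          (Finset.sum_coe_sort _ fun i => u i ^ 2).symm
      _ ≤ ∑ i : (I \ S : Finset (Fin d)), w (e i) ^ 2 := by
          refine Finset.sum_le_sum fun i _ => sq_le_sq.2 ?_
          exact hu i (Finset.mem_sdiff.1 i.2).2 _ (Finset.mem_sdiff.1 (hTS (e i).2)).1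
      _ = ∑ j : T, w j ^ 2 := e.sum_comp fun j : T => w j ^ 2
      _ = ∑ j ∈ T, w j ^ 2 := Finset.sum_coe_sort T fun j => w j ^ 2
      _ ≤ _ := Finset.sum_le_sum_of_subset_of_nonneg hTS fun _ _ _ => sq_nonneg _
  calc ∑ i ∈ I, u i ^ 2 = ∑ i ∈ I ∩ S, u i ^ 2 + ∑ i ∈ I \ S, u i ^ 2 :=
        (Finset.sum_inter_add_sum_sdiff I S _).symm
    _ ≤ ∑ i ∈ S ∩ I, w i ^ 2 + ∑ i ∈ S \ I, w i ^ 2 := by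
        refine add_le_add (le_of_eq ?_) hsum
        rw [Finset.inter_comm]
        exact Finset.sum_congr rfl fun i hi => by rw [huS i (Finset.mem_inter.1 hi).1]
    _ = ∑ i ∈ S, w i ^ 2 := Finset.sum_inter_add_sum_sdiff S I _
    _ ≤ ∑ i, w i ^ 2 :=
        Finset.sum_le_sum_of_subset_of_nonneg (Finset.subset_univ S) fun _ _ _ => sq_nonneg _
    _ = ‖w‖ ^ 2 := (EuclideanSpace.real_norm_sq_eq w).symm

theorem convexOn_kSupportNorm (hk : 1 ≤ k) :
    ConvexOn ℝ Set.univ (kSupportNorm k : EuclideanSpace ℝ (Fin d) → ℝ) :=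
  ⟨convex_univ, fun x _ y _ _ _ ha hb _ => (kSupportNorm_add_le hk _ _).trans
    (add_le_add (kSupportNorm_smul_le hk ha x) (kSupportNorm_smul_le hk hb y))⟩

theorem convexOn_regF (hk : 1 ≤ k) {α : ℝ} (hα : α ≤ 1) :
    ConvexOn ℝ Set.univ (regF k α : EuclideanSpace ℝ (Fin d) → ℝ) :=
  ((convexOn_kSupportNorm hk).pow (fun x _ => kSupportNorm_nonneg x) 2).smul
    (c := (1 - α) / 2) (by linarith)

theorem regF_nonneg {α : ℝ} (hα : α ≤ 1) (w : EuclideanSpace ℝ (Fin d)) : 0 ≤ regF k α w :=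
  mul_nonneg (by linarith) (sq_nonneg _)

/-- `(1 - α) u` is a subgradient of `regF k α` at a vector `w` with at most `k` nonzero entries,
when `u` agrees with `w` on its support and is dominated there by the smallest entry of `w`. -/
theorem regF_add_inner_le (hk : 1 ≤ k) {α : ℝ} (hα : α ≤ 1) {S : Finset (Fin d)}
    (hS : S.card = k) {u w : EuclideanSpace ℝ (Fin d)} (hw : ∀ i, i ∉ S → w i = 0)
    (huS : ∀ i ∈ S, u i = w i) (hu : ∀ l, l ∉ S → ∀ j ∈ S, |u l| ≤ |w j|)
    (x : EuclideanSpace ℝ (Fin d)) :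
    regF k α w + (1 - α) * inner ℝ u (x - w) ≤ regF k α x := by
  have h1 : inner ℝ u x ≤ ‖w‖ * kSupportNorm k x :=
    inner_le_mul_kSupportNorm hk (norm_nonneg w)
      (fun I hI => sum_sq_le_norm_sq huS hu I (hI.trans hS.ge)) x
  have h2 : inner ℝ u w = ‖w‖ ^ 2 := by
    rw [EuclideanSpace.real_norm_sq_eq, inner_eq_dotProduct, dotProduct]
    refine Finset.sum_congr rfl fun i _ => ?_
    by_cases hi : i ∈ S
    · rw [huS i hi, sq]
    · rw [hw i hi]; norm_num
  have h3 : kSupportNorm k w ^ 2 ≤ ‖w‖ ^ 2 :=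
    pow_le_pow_left₀ (kSupportNorm_nonneg w) (kSupportNorm_le_norm hS.le hw) 2
  -- Fenchel-Young: `⟨u, x⟩ ≤ ‖w‖ ‖x‖_k ≤ (‖w‖² + ‖x‖_k²)/2`, while `⟨u, w⟩ = ‖w‖²`.
  have h4 : kSupportNorm k w ^ 2 / 2 + inner ℝ u (x - w) ≤ kSupportNorm k x ^ 2 / 2 := by
    rw [inner_sub_right, h2]
    nlinarith [sq_nonneg (‖w‖ - kSupportNorm k x)]
  have h5 := mul_le_mul_of_nonneg_left h4 (sub_nonneg.2 hα)
  unfold regF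
  linarith

end KSupport

/-! ### The proximal operator -/

section Prox

variable {d : ℕ} {h : EuclideanSpace ℝ (Fin d) → ℝ}

/-- A finite convex function on a finite-dimensional space is continuous, and `h ≥ 0` makes the
objective coercive; so the minimum is attained and the choice in `prox` is a genuine minimizer. -/
theorem prox_isMinimizer (hconv : ConvexOn ℝ Set.univ h) (hnonneg : ∀ w, 0 ≤ h w)
    (z u : EuclideanSpace ℝ (Fin d)) :
    h (prox h z) + 1 / 2 * ‖prox h z - z‖ ^ 2 ≤ h u + 1 / 2 * ‖u - z‖ ^ 2 := by
  have hcont : Continuous h := by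
    rw [← continuousOn_univ]
    exact hconv.continuousOn isOpen_univ
  have hlim : Filter.Tendsto (fun w => h w + 1 / 2 * ‖w - z‖ ^ 2)
      (Filter.cocompact (EuclideanSpace ℝ (Fin d))) Filter.atTop := by
    refine Filter.tendsto_atTop_mono (fun w => le_add_of_nonneg_left (hnonneg w)) ?_
    refine Filter.Tendsto.const_mul_atTop (by norm_num) ?_
    refine (Filter.tendsto_pow_atTop two_ne_zero).comp ?_
    simpa only [dist_eq_norm] using tendsto_dist_right_cocompact_atTop z
  have hex := (show Continuous fun w => h w + 1 / 2 * ‖w - z‖ ^ 2 by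
    fun_prop).exists_forall_le hlim
  exact Classical.epsilon_spec (p := fun w => ∀ u, h w + 1 / 2 * ‖w - z‖ ^ 2 ≤
    h u + 1 / 2 * ‖u - z‖ ^ 2) hex u

/-- The residual `z - prox_h(z)` is a subgradient of `h` at `prox_h(z)`. -/
theorem prox_add_inner_le (hconv : ConvexOn ℝ Set.univ h) (hnonneg : ∀ w, 0 ≤ h w)
    (z u : EuclideanSpace ℝ (Fin d)) :
    h (prox h z) + inner ℝ (z - prox h z) (u - prox h z) ≤ h u := by
  have hmin := prox_isMinimizer hconv hnonneg z
  set p := prox h z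
  -- Compare `p` with a point of the segment towards `u`, divide by `s`, then let `s` tend to `0`.
  have key : ∀ s : ℝ, 0 < s → s ≤ 1 →
      h p + inner ℝ (z - p) (u - p) ≤ h u + s * (‖u - p‖ ^ 2 / 2) := by
    intro s hs hs1
    have h1 := hmin ((1 - s) • p + s • u)
    have h2 := hconv.2 (Set.mem_univ p) (Set.mem_univ u) (sub_nonneg.2 hs1) hs.le (by ring)
    have h3 : (1 - s) • p + s • u - z = s • (u - p) - (z - p) := by module
    rw [h3, norm_sub_sq_real (s • (u - p)), norm_smul, real_inner_smul_left, norm_sub_rev p z,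
      real_inner_comm, Real.norm_eq_abs, mul_pow, sq_abs] at h1
    simp only [smul_eq_mul] at h2
    have h4 : 0 ≤ s * (h u + s * (‖u - p‖ ^ 2 / 2) - (h p + inner ℝ (z - p) (u - p))) := by
      nlinarith
    linarith [(mul_nonneg_iff_of_pos_left hs).1 h4]
  refine le_of_forall_pos_le_add fun ε hε => ?_
  set C := ‖u - p‖ ^ 2 / 2 with hC
  have hC0 : 0 ≤ C := by positivity
  have hs : 0 < min 1 (ε / (C + 1)) := lt_min one_pos (by positivity)
  refine (key _ hs (min_le_left _ _)).trans (add_le_add le_rfl ?_)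
  calc min 1 (ε / (C + 1)) * C ≤ ε / (C + 1) * (C + 1) :=
        mul_le_mul (min_le_right _ _) (by linarith) hC0 (by positivity)
    _ = ε := div_mul_cancel₀ _ (by positivity)

end Prox

/-! ### The dual objective -/

section Dual

variable {n d : ℕ} {X : Matrix (Fin n) (Fin d) ℝ} {k : ℕ} {α : ℝ}

/-- Strong convexity of `J = F + α/2 ‖·‖²` at `primal X k α v`, with subgradient `-Xᵀ v`. -/
theorem primal_strong_subgradient (hk : 1 ≤ k) (hα0 : 0 < α) (hα1 : α ≤ 1)
    (v : EuclideanSpace ℝ (Fin n)) (u : EuclideanSpace ℝ (Fin d)) :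
    regF k α (primal X k α v) + α / 2 * ‖primal X k α v‖ ^ 2
        - inner ℝ v (act X (u - primal X k α v)) + α / 2 * ‖u - primal X k α v‖ ^ 2
      ≤ regF k α u + α / 2 * ‖u‖ ^ 2 := by
  have h := prox_add_inner_le (h := fun w => α⁻¹ * regF k α w)
    ((convexOn_regF hk hα1).smul (c := α⁻¹) (by positivity))
    (fun w => mul_nonneg (by positivity) (regF_nonneg hα1 w)) (-(α⁻¹ • act X.transpose v)) u
  change α⁻¹ * regF k α (primal X k α v) + inner ℝ (-(α⁻¹ • act X.transpose v) -
    primal X k α v) (u - primal X k α v) ≤ α⁻¹ * regF k α u at h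
  set p := primal X k α v
  rw [inner_sub_left, inner_neg_left, real_inner_smul_left, inner_act_transpose] at h
  have h2 := mul_le_mul_of_nonneg_left h hα0.le
  have e : α * (α⁻¹ * regF k α p + (-(α⁻¹ * inner ℝ v (act X (u - p))) - inner ℝ p (u - p))) =
      regF k α p - inner ℝ v (act X (u - p)) - α * inner ℝ p (u - p) := by
    field_simp
    ring
  rw [e, mul_inv_cancel_left₀ hα0.ne'] at h2
  have h3 : ‖u‖ ^ 2 = ‖p‖ ^ 2 + 2 * inner ℝ p (u - p) + ‖u - p‖ ^ 2 := by
    rw [← norm_add_sq_real, add_sub_cancel]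
  rw [h3]
  linarith

/-- The dual objective `J*(-Xᵀ v) + ⟨y, v⟩` where `J = F + α/2 ‖·‖²`. -/
noncomputable def dualObjective (X : Matrix (Fin n) (Fin d) ℝ) (k : ℕ) (α : ℝ)
    (y v : EuclideanSpace ℝ (Fin n)) : ℝ :=
  -inner ℝ v (act X (primal X k α v)) - regF k α (primal X k α v)
    - α / 2 * ‖primal X k α v‖ ^ 2 + inner ℝ y v

/-- Convexity of the dual objective, with gradient `y - X P(v)`: the conjugate at `u` is at least
its value tested at the competitor `P(v)`. -/
theorem dualObjective_add_inner_le (hk : 1 ≤ k) (hα0 : 0 < α) (hα1 : α ≤ 1)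
    (y v u : EuclideanSpace ℝ (Fin n)) :
    dualObjective X k α y v + inner ℝ (y - act X (primal X k α v)) (u - v)
      ≤ dualObjective X k α y u := by
  have h := primal_strong_subgradient (X := X) hk hα0 hα1 u (primal X k α v)
  have h2 : 0 ≤ α / 2 * ‖primal X k α v - primal X k α u‖ ^ 2 := by positivity
  unfold dualObjective
  simp only [act_sub, inner_sub_right, inner_sub_left] at h ⊢
  rw [real_inner_comm u (act X (primal X k α v)), real_inner_comm v (act X (primal X k α v))]
  linarith

/-- The descent inequality, without differentiating: strong convexity at `P(v)` is tested at `P(z)`,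
and Young's inequality absorbs the cross term into `α/2 ‖P(z) - P(v)‖²`. -/
theorem dualObjective_le (hk : 1 ≤ k) (hα0 : 0 < α) (hα1 : α ≤ 1)
    (y v z : EuclideanSpace ℝ (Fin n)) :
    dualObjective X k α y z ≤ dualObjective X k α y v
      + inner ℝ (y - act X (primal X k α v)) (z - v)
      + opNorm X ^ 2 / (2 * α) * ‖z - v‖ ^ 2 := by
  have h := primal_strong_subgradient (X := X) hk hα0 hα1 v (primal X k α z)
  have h2 : -inner ℝ (z - v) (act X (primal X k α z - primal X k α v)) ≤
      α / 2 * ‖primal X k α z - primal X k α v‖ ^ 2 +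
      opNorm X ^ 2 / (2 * α) * ‖z - v‖ ^ 2 := by
    set r := primal X k α z - primal X k α v
    have h3 : -inner ℝ (z - v) (act X r) ≤ ‖z - v‖ * (opNorm X * ‖r‖) :=
      (neg_le_abs _).trans ((abs_real_inner_le_norm _ _).trans
        (mul_le_mul_of_nonneg_left (norm_act_le X r) (norm_nonneg _)))
    have h4 : 0 ≤ (α * ‖r‖ - opNorm X * ‖z - v‖) ^ 2 / (2 * α) := by positivity
    have h5 : (α * ‖r‖ - opNorm X * ‖z - v‖) ^ 2 / (2 * α) = α / 2 * ‖r‖ ^ 2 +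
        opNorm X ^ 2 / (2 * α) * ‖z - v‖ ^ 2 - ‖z - v‖ * (opNorm X * ‖r‖) := by
      field_simp
      ring
    linarith
  unfold dualObjective
  simp only [act_sub, inner_sub_right, inner_sub_left] at h h2 ⊢
  rw [real_inner_comm v (act X (primal X k α v)), real_inner_comm z (act X (primal X k α v))]
  linarith

end Dual

/-! ### The sequence `θ` -/

theorem one_le_theta (t : ℕ) : 1 ≤ theta t := by
  cases t with
  | zero => exact le_rfl
  | succ t =>
    have : 1 ≤ √(1 + 4 * theta t ^ 2) := Real.one_le_sqrt.2 (by nlinarith [sq_nonneg (theta t)])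
    simp only [theta]
    linarith

/-- This relation makes the weights of the gap telescope from one step to the next. -/
theorem theta_succ_sq_sub (t : ℕ) : theta (t + 1) ^ 2 - theta (t + 1) = theta t ^ 2 := by
  have h : √(1 + 4 * theta t ^ 2) ^ 2 = 1 + 4 * theta t ^ 2 := Real.sq_sqrt (by positivity)
  simp only [theta]
  linear_combination h / 4

theorem theta_lower (t : ℕ) : ((t : ℝ) + 2) / 2 ≤ theta t := by
  induction t with
  | zero => simp [theta]
  | succ t ih =>
    have h1 := one_le_theta t
    have h : 2 * theta t ≤ √(1 + 4 * theta t ^ 2) := Real.le_sqrt_of_sq_le (by nlinarith)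
    simp only [theta]
    push_cast
    linarith

theorem theta_upper (t : ℕ) : theta t ≤ t + 1 := by
  induction t with
  | zero => simp [theta]
  | succ t ih =>
    have h1 := one_le_theta t
    have h : √(1 + 4 * theta t ^ 2) ≤ 1 + 2 * theta t :=
      (Real.sqrt_le_left (by linarith)).2 (by nlinarith)
    simp only [theta]
    push_cast
    linarith

/-! ### Accelerated gradient descent with a constant perturbation of the gradient -/

section Accelerated

variable {E : Type*} [NormedAddCommGroup E] [InnerProductSpace ℝ E]

/-- One step of accelerated gradient descent on `D`, with the perturbed gradient `G + e`. -/
theorem accelerated_step {D : E → ℝ} {G : E → E} {γ θ Dstar : ℝ} (hγ : 0 < γ) (hθ : 1 ≤ θ)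
    {e p v z x : E} (hz : z = v - γ • (G v + e))
    (hsmooth : D z ≤ D v + inner ℝ (G v) (z - v) + 1 / (2 * γ) * ‖z - v‖ ^ 2)
    (hp : D v + inner ℝ (G v) (p - v) ≤ D p)
    (hx : D v + inner ℝ (G v) (x - v) ≤ Dstar) :
    θ ^ 2 * (D z - Dstar) + 1 / (2 * γ) * ‖θ • z - (θ - 1) • p - x‖ ^ 2 ≤
      (θ ^ 2 - θ) * (D p - Dstar) + 1 / (2 * γ) * ‖θ • v - (θ - 1) • p - x‖ ^ 2
        + θ * (‖e‖ * ‖θ • z - (θ - 1) • p - x‖) := by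
  -- The three inequalities are added with weights `θ²`, `θ² - θ` and `θ`; the values `D v` cancel.
  have hcomb : θ ^ 2 * (D z - Dstar) ≤ (θ ^ 2 - θ) * (D p - Dstar)
      + θ * inner ℝ (G v) (θ • z - (θ - 1) • p - x) + θ ^ 2 / (2 * γ) * ‖z - v‖ ^ 2 := by
    have h1 := mul_le_mul_of_nonneg_left hsmooth (sq_nonneg θ)
    have h2 := mul_le_mul_of_nonneg_left hp (show 0 ≤ θ ^ 2 - θ by nlinarith)
    have h3 := mul_le_mul_of_nonneg_left hx (show 0 ≤ θ by linarith)
    simp only [inner_sub_right, real_inner_smul_right] at h1 h2 h3 ⊢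
    have h4 : θ ^ 2 * (1 / (2 * γ) * ‖z - v‖ ^ 2) = θ ^ 2 / (2 * γ) * ‖z - v‖ ^ 2 := by ring
    linarith
  have hG : G v = -(γ⁻¹ • (z - v)) - e := by
    rw [hz, sub_sub_cancel_left, smul_neg, inv_smul_smul₀ hγ.ne']
    abel
  set U := θ • z - (θ - 1) • p - x with hU
  have hV : θ • v - (θ - 1) • p - x = U - θ • (z - v) := by
    rw [hU]; module
  have hinner : θ * inner ℝ (G v) U = -(θ / γ * inner ℝ (z - v) U) - θ * inner ℝ e U := by
    rw [hG, inner_sub_left, inner_neg_left, real_inner_smul_left]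
    ring
  have he : -inner ℝ e U ≤ ‖e‖ * ‖U‖ := (neg_le_abs _).trans (abs_real_inner_le_norm _ _)
  have he' := mul_le_mul_of_nonneg_left he (show 0 ≤ θ by linarith)
  rw [hV, norm_sub_sq_real U, real_inner_smul_right, norm_smul, Real.norm_eq_abs, mul_pow, sq_abs,
    real_inner_comm (z - v) U]
  have h6 : 1 / (2 * γ) * (‖U‖ ^ 2 - 2 * (θ * inner ℝ (z - v) U) + θ ^ 2 * ‖z - v‖ ^ 2) =
      1 / (2 * γ) * ‖U‖ ^ 2 - θ / γ * inner ℝ (z - v) U + θ ^ 2 / (2 * γ) * ‖z - v‖ ^ 2 := by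
    field_simp
  rw [h6]
  linarith

end Accelerated

/-- If `E_t + ρ_t² / (2γ)` grows by at most `θ_t δ ρ_{t+1}` in step `t`, then `E_{t+1}` is at most
`(R + 2γδθ_t²)² / (2γ)`. -/
theorem energy_bound {E ρ : ℕ → ℝ} {γ δ R : ℝ} (hγ : 0 < γ) (hδ : 0 ≤ δ) (hR : 0 ≤ R)
    (hE : ∀ t, 0 ≤ E t) (hρ : ∀ t, 0 ≤ ρ t)
    (h0 : E 0 + 1 / (2 * γ) * ρ 0 ^ 2 ≤ 1 / (2 * γ) * R ^ 2)
    (hstep : ∀ t, E (t + 1) + 1 / (2 * γ) * ρ (t + 1) ^ 2 ≤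
      E t + 1 / (2 * γ) * ρ t ^ 2 + theta t * (δ * ρ (t + 1))) (t : ℕ) :
    E (t + 1) ≤ 1 / (2 * γ) * (R + 2 * γ * δ * theta t ^ 2) ^ 2 := by
  -- Summing the steps, with `∑_{s ≤ t} θ_s = θ_t²`.
  have hsum : ∀ (B : ℝ) (t : ℕ), (∀ s ≤ t + 1, ρ s ≤ B) →
      E (t + 1) + 1 / (2 * γ) * ρ (t + 1) ^ 2 ≤
        1 / (2 * γ) * R ^ 2 + theta t ^ 2 * (δ * B) := by
    intro B t
    induction t with
    | zero =>
      intro hB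
      have h1 := hstep 0
      have h2 : δ * ρ 1 ≤ δ * B := mul_le_mul_of_nonneg_left (hB 1 le_rfl) hδ
      simp only [theta, zero_add] at h1 ⊢
      linarith
    | succ t ih =>
      intro hB
      have h1 := ih fun s hs => hB s (by omega)
      have h2 := hstep (t + 1)
      have h3 : theta (t + 1) * (δ * ρ (t + 1 + 1)) ≤ theta (t + 1) * (δ * B) :=
        mul_le_mul_of_nonneg_left (mul_le_mul_of_nonneg_left (hB _ le_rfl) hδ)
          (by linarith [one_le_theta (t + 1)])
      have h4 := theta_succ_sq_sub t
      have h5 : theta (t + 1) ^ 2 * (δ * B) = theta t ^ 2 * (δ * B) +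
        theta (t + 1) * (δ * B) := by rw [← h4]; ring
      linarith
  have hmono : Monotone theta := monotone_nat_of_le_succ fun s => by
    have h1 := theta_succ_sq_sub s
    have h2 := one_le_theta s
    have h3 := one_le_theta (s + 1)
    nlinarith
  have hpos : 0 ≤ 2 * γ * δ * theta t ^ 2 := by positivity
  have hρB : ∀ s ≤ t + 1, ρ s ≤ R + 2 * γ * δ * theta t ^ 2 := by
    -- The a priori bound on `ρ` comes from its own maximum: with `B = ρ m`, the summed estimate is
    -- a quadratic inequality `ρ_m² ≤ R² + C ρ_m`, which forces `ρ_m ≤ R + C`.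
    obtain ⟨m, hm, hmax⟩ := Finset.exists_max_image (Finset.range (t + 2)) ρ ⟨0, by simp⟩
    have hm' : ρ m ^ 2 ≤ R ^ 2 + 2 * γ * δ * theta t ^ 2 * ρ m := by
      have key : 1 / (2 * γ) * ρ m ^ 2 ≤ 1 / (2 * γ) * R ^ 2 + theta t ^ 2 * (δ * ρ m) := by
        have hδm : 0 ≤ δ * ρ m := mul_nonneg hδ (hρ m)
        cases m with
        | zero =>
          have := mul_nonneg (sq_nonneg (theta t)) hδm
          linarith [hE 0]
        | succ m =>
          have hmt : m ≤ t := by simp only [Finset.mem_range] at hm; omega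
          have h1 := hsum (ρ (m + 1)) m fun s hs => hmax s (by simp; omega)
          have h2 : theta m ^ 2 * (δ * ρ (m + 1)) ≤ theta t ^ 2 * (δ * ρ (m + 1)) :=
            mul_le_mul_of_nonneg_right
              (pow_le_pow_left₀ (by linarith [one_le_theta m]) (hmono hmt) 2) hδm
          linarith [hE (m + 1)]
      have h2 := mul_le_mul_of_nonneg_left key (show 0 ≤ 2 * γ by linarith)
      have e1 : 2 * γ * (1 / (2 * γ) * ρ m ^ 2) = ρ m ^ 2 := by field_simp
      have e2 : 2 * γ * (1 / (2 * γ) * R ^ 2 + theta t ^ 2 * (δ * ρ m)) =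
          R ^ 2 + 2 * γ * δ * theta t ^ 2 * ρ m := by field_simp
      rwa [e1, e2] at h2
    intro s hs
    refine (hmax s (by simp; omega)).trans ?_
    by_contra! hlt
    nlinarith [hρ m]
  have h1 := hsum _ t hρB
  have h2 : 0 ≤ 1 / (2 * γ) * ρ (t + 1) ^ 2 := by positivity
  have h3 : 1 / (2 * γ) * (R + 2 * γ * δ * theta t ^ 2) ^ 2 = 1 / (2 * γ) * R ^ 2 +
      theta t ^ 2 * (δ * (R + 2 * γ * δ * theta t ^ 2)) + theta t ^ 2 * δ * R := by
    field_simp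
    ring
  have h4 : 0 ≤ theta t ^ 2 * δ * R := by positivity
  linarith

/-! ### Convergence of the iterates -/

section Convergence

variable {n d : ℕ} {X : Matrix (Fin n) (Fin d) ℝ} {k : ℕ} {α : ℝ}

/-- `-v` solves the dual problem at the primal solution `w`. -/
def IsDualCertificate (X : Matrix (Fin n) (Fin d) ℝ) (k : ℕ) (α : ℝ)
    (w : EuclideanSpace ℝ (Fin d)) (v : EuclideanSpace ℝ (Fin n)) : Prop :=
  ∀ u, regF k α w + α / 2 * ‖w‖ ^ 2 + inner ℝ v (act X (u - w)) ≤ regF k α u + α / 2 * ‖u‖ ^ 2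

/-- Turns dual gaps into primal distances, and shows that `-J(w)` is a lower bound for the dual
objective. -/
theorem norm_sub_sq_le_dualObjective_sub (hk : 1 ≤ k) (hα0 : 0 < α) (hα1 : α ≤ 1)
    (w : EuclideanSpace ℝ (Fin d)) (z : EuclideanSpace ℝ (Fin n)) :
    α / 2 * ‖primal X k α z - w‖ ^ 2 ≤
      dualObjective X k α (act X w) z + (regF k α w + α / 2 * ‖w‖ ^ 2) := by
  have h := primal_strong_subgradient (X := X) hk hα0 hα1 z w
  unfold dualObjective
  rw [norm_sub_rev]
  simp only [act_sub, inner_sub_right] at h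
  rw [real_inner_comm z (act X w)]
  linarith

/-- The certificate tested at `P(v)`: every linearization of the dual objective, evaluated at `-q`,
lies below the optimal value `-J(w)`. -/
theorem IsDualCertificate.dualObjective_add_inner_le {w : EuclideanSpace ℝ (Fin d)}
    {q : EuclideanSpace ℝ (Fin n)} (hq : IsDualCertificate X k α w q)
    (v : EuclideanSpace ℝ (Fin n)) :
    dualObjective X k α (act X w) v + inner ℝ (act X w - act X (primal X k α v)) (-q - v) ≤
      -(regF k α w + α / 2 * ‖w‖ ^ 2) := by
  have h := hq (primal X k α v)
  unfold dualObjective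
  simp only [act_sub, inner_sub_right, inner_sub_left, inner_neg_right] at h ⊢
  rw [real_inner_comm q (act X (primal X k α v)), real_inner_comm v (act X (primal X k α v)),
    real_inner_comm q (act X w)]
  linarith

theorem IsDualCertificate.norm_iterate_sub_le (hk : 1 ≤ k) (hα0 : 0 < α) (hα1 : α ≤ 1)
    (hX : 0 < opNorm X) {w : EuclideanSpace ℝ (Fin d)} {q : EuclideanSpace ℝ (Fin n)}
    (hq : IsDualCertificate X k α w q) {yδ v₀ : EuclideanSpace ℝ (Fin n)} {δ : ℝ}
    (hnoise : ‖yδ - act X w‖ ≤ δ) (t : ℕ) :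
    ‖iterate X k α yδ v₀ t - w‖ ≤
      opNorm X * ‖v₀ + q‖ / (α * theta t) + 2 * δ * theta t / opNorm X := by
  have hδ : 0 ≤ δ := (norm_nonneg _).trans hnoise
  set γ := α * (opNorm X ^ 2)⁻¹ with hγdef
  have hγ : 0 < γ := by positivity
  set J := regF k α w + α / 2 * ‖w‖ ^ 2
  set s := dualState X k α yδ v₀ with hs
  set E : ℕ → ℝ := fun t => (theta t ^ 2 - theta t) *
    (dualObjective X k α (act X w) (s t).1 - -J) with hE
  set ρ : ℕ → ℝ := fun t => ‖theta t • (s t).2 - (theta t - 1) • (s t).1 - -q‖ with hρ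
  have hgap : ∀ z, 0 ≤ dualObjective X k α (act X w) z - -J := fun z => by
    have h1 := norm_sub_sq_le_dualObjective_sub (X := X) hk hα0 hα1 w z
    have h2 : 0 ≤ α / 2 * ‖primal X k α z - w‖ ^ 2 := by positivity
    rw [sub_neg_eq_add]
    exact h2.trans h1
  have hE0 : ∀ t, 0 ≤ E t := fun t => mul_nonneg (by nlinarith [one_le_theta t]) (hgap _)
  have hEsucc : ∀ t, E (t + 1) = theta t ^ 2 *
      (dualObjective X k α (act X w) (dualIterate X k α yδ v₀ t) - -J) := fun t => by
    simp only [hE, theta_succ_sq_sub]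
    rfl
  have hρsucc : ∀ t, ρ (t + 1) =
      ‖theta t • dualIterate X k α yδ v₀ t - (theta t - 1) • (s t).1 - -q‖ := fun t => by
    -- The momentum coefficient `(θ_t - 1)/θ_{t+1}` is the one for which the auxiliary point after
    -- step `t` is the one before step `t + 1`.
    have h1 : theta (t + 1) ≠ 0 := by linarith [one_le_theta (t + 1)]
    change ‖theta (t + 1) • (dualIterate X k α yδ v₀ t + ((theta t - 1) / theta (t + 1)) •
      (dualIterate X k α yδ v₀ t - (s t).1)) - (theta (t + 1) - 1) • dualIterate X k α yδ v₀ t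
      - -q‖ = _
    congr 2
    rw [smul_add, smul_smul, mul_div_cancel₀ _ h1]
    module
  have hstep : ∀ t, E (t + 1) + 1 / (2 * γ) * ρ (t + 1) ^ 2 ≤
      E t + 1 / (2 * γ) * ρ t ^ 2 + theta t * (δ * ρ (t + 1)) := fun t => by
    rw [hEsucc, hρsucc]
    have hL : opNorm X ^ 2 / (2 * α) = 1 / (2 * γ) := by
      rw [hγdef]; field_simp
    have hsmooth := dualObjective_le (X := X) hk hα0 hα1 (act X w) (s t).2
      (dualIterate X k α yδ v₀ t)
    rw [hL] at hsmooth
    refine (accelerated_step (D := dualObjective X k α (act X w))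
      (G := fun v => act X w - act X (primal X k α v)) (e := yδ - act X w) (x := -q) hγ
      (one_le_theta t) ?_ hsmooth
      (IRKSN.dualObjective_add_inner_le hk hα0 hα1 (act X w) (s t).2 (s t).1)
      (hq.dualObjective_add_inner_le (s t).2)).trans ?_
    · rw [dualIterate, dualStep, ← hγdef]
      module
    · have h2 := mul_le_mul_of_nonneg_left (mul_le_mul_of_nonneg_right hnoise
        (norm_nonneg (theta t • dualIterate X k α yδ v₀ t - (theta t - 1) • (s t).1 - -q)))
        (zero_le_one.trans (one_le_theta t))
      exact add_le_add le_rfl h2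
  -- As `θ_0 = 1`, the gap has weight zero and only the distance from `v₀` to `-q` remains.
  have h0 : E 0 + 1 / (2 * γ) * ρ 0 ^ 2 ≤ 1 / (2 * γ) * ‖v₀ + q‖ ^ 2 := by
    simp [hE, hρ, hs, theta, dualState]
  have hmain := energy_bound (ρ := ρ) hγ hδ (norm_nonneg (v₀ + q)) hE0
    (fun t => norm_nonneg _) h0 hstep t
  rw [hEsucc, sub_neg_eq_add] at hmain
  have hθ : 0 < theta t := zero_lt_one.trans_le (one_le_theta t)
  have hsc := mul_le_mul_of_nonneg_left
    (norm_sub_sq_le_dualObjective_sub (X := X) hk hα0 hα1 w (dualIterate X k α yδ v₀ t))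
    (sq_nonneg (theta t))
  have hR : 0 ≤ opNorm X * ‖v₀ + q‖ / (α * theta t) + 2 * δ * theta t / opNorm X := by positivity
  refine (sq_le_sq₀ (norm_nonneg _) hR).1 ?_
  have hfin := hsc.trans hmain
  have e : 1 / (2 * γ) * (‖v₀ + q‖ + 2 * γ * δ * theta t ^ 2) ^ 2 = theta t ^ 2 * (α / 2 *
      (opNorm X * ‖v₀ + q‖ / (α * theta t) + 2 * δ * theta t / opNorm X) ^ 2) := by
    rw [hγdef]
    field_simp
  rw [e] at hfin
  have h1 := le_of_mul_le_mul_left hfin (by positivity)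
  exact le_of_mul_le_mul_left h1 (by positivity)

/-- Under the `ℓ_∞` gap conditions, `(X_Sᵀ)† w_S` certifies the optimality of `w`. -/
theorem isDualCertificate_pinv {w : EuclideanSpace ℝ (Fin d)}
    {y : EuclideanSpace ℝ (Fin n)} (hk : 1 ≤ k) {S : Finset (Fin d)}
    (hcard : S.card = k) (hS : ∀ i, i ∈ S ↔ w i ≠ 0) (hsol : act X w = y)
    (hmin : ∀ z : EuclideanSpace ℝ S, act (colsOn X S) z = y → ‖restr S w‖ ≤ ‖z‖)
    (hα0 : 0 < α) (hα1 : α < 1)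
    (hα : ∀ l, l ∉ S → ∀ j ∈ S, α <
      (|inner ℝ (act (pinv (colsOn X S * (colsOn X S).transpose)) y) (column X j)| -
        |inner ℝ (act (pinv (colsOn X S * (colsOn X S).transpose)) y) (column X l)|)
          / linftyNorm w) :
    IsDualCertificate X k α w (act (pinv (colsOn X S).transpose) (restr S w)) := by
  have hw0 : ∀ i, i ∉ S → w i = 0 := fun i hi => by_contra fun h => hi ((hS i).2 h)
  have hy : act (colsOn X S) (restr S w) = y := (act_colsOn_restr X S w hw0).trans hsol
  set q := act (pinv (colsOn X S).transpose) (restr S w) with hq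
  have hpy : act (pinv (colsOn X S * (colsOn X S).transpose)) y = q := by
    rw [← hy, ← act_mul, pinv_mul_transpose_mul]
  have hrow : restr S (act X.transpose q) = restr S w := by
    rw [← act_colsOn_transpose]
    exact act_transpose_pinv_transpose_of_least_norm _ _ fun z hz => hmin z (hz.trans hy)
  have hqS : ∀ i ∈ S, act X.transpose q i = w i := fun i hi =>
    congrArg (fun f : EuclideanSpace ℝ S => f ⟨i, hi⟩) hrow
  have hα1' : 0 < 1 - α := sub_pos.2 hα1
  -- What remains of `Xᵀ q` for `F` once `α w`, the gradient of `α/2 ‖·‖²`, is removed.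
  set u := (1 - α)⁻¹ • (act X.transpose q - α • w) with hu
  have huS : ∀ i ∈ S, u i = w i := fun i hi => by
    simp only [hu, PiLp.smul_apply, PiLp.sub_apply, smul_eq_mul, hqS i hi]
    field_simp
  have huSc : ∀ l, l ∉ S → ∀ j ∈ S, |u l| ≤ |w j| := fun l hl j hj => by
    have hle : |w j| ≤ linftyNorm w := norm_le_pi_norm w.ofLp j
    have hpos : 0 < linftyNorm w := (abs_pos.2 ((hS j).1 hj)).trans_le hle
    have h := hα l hl j hj
    rw [hpy, ← act_transpose_apply, ← act_transpose_apply, hqS j hj, lt_div_iff₀ hpos] at h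
    -- `|(Xᵀ q)_l| < |w_j| - α ‖w‖_∞ ≤ (1 - α) |w_j|`.
    have h2 := mul_le_mul_of_nonneg_left hle hα0.le
    simp only [hu, PiLp.smul_apply, PiLp.sub_apply, smul_eq_mul, hw0 l hl, mul_zero, sub_zero,
      abs_mul, abs_inv, abs_of_pos hα1']
    rw [inv_mul_le_iff₀ hα1']
    linarith
  intro x
  have h := regF_add_inner_le hk hα1.le hcard hw0 huS huSc x
  rw [← inner_act_transpose]
  have e : act X.transpose q = (1 - α) • u + α • w := by
    rw [hu, smul_inv_smul₀ hα1'.ne', sub_add_cancel]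
  rw [e, inner_add_left, real_inner_smul_left u, real_inner_smul_left w]
  have h3 : ‖x‖ ^ 2 = ‖w‖ ^ 2 + 2 * inner ℝ w (x - w) + ‖x - w‖ ^ 2 := by
    rw [← norm_add_sq_real, add_sub_cancel]
  have h4 : 0 ≤ α / 2 * ‖x - w‖ ^ 2 := by positivity
  rw [h3]
  linarith

/-- A least-norm representation with a nonzero coefficient needs a nonzero matrix. -/
theorem opNorm_pos_of_least_norm {w : EuclideanSpace ℝ (Fin d)}
    {y : EuclideanSpace ℝ (Fin n)} {S : Finset (Fin d)}
    (hSne : S.Nonempty) (hS : ∀ i ∈ S, w i ≠ 0) (hsol : act X w = y)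
    (hmin : ∀ z : EuclideanSpace ℝ S, act (colsOn X S) z = y → ‖restr S w‖ ≤ ‖z‖) :
    0 < opNorm X := by
  refine (opNorm_nonneg X).lt_of_ne fun h => ?_
  obtain ⟨i, hi⟩ := hSne
  have hy : y = 0 := by
    have := norm_act_le X w
    rw [← h, zero_mul, hsol] at this
    exact norm_le_zero_iff.1 this
  have h1 := hmin 0 (by rw [hy]; simp [act])
  rw [norm_zero, norm_le_zero_iff] at h1
  exact hS i hi (congrArg (fun f : EuclideanSpace ℝ S => f ⟨i, hi⟩) h1)

theorem IsDualCertificate.norm_iterate_sub_le_of_pos (hk : 1 ≤ k) (hα0 : 0 < α) (hα1 : α ≤ 1)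
    (hX : 0 < opNorm X) {w : EuclideanSpace ℝ (Fin d)} {q : EuclideanSpace ℝ (Fin n)}
    (hq : IsDualCertificate X k α w q) {yδ v₀ : EuclideanSpace ℝ (Fin n)} {δ : ℝ}
    (hnoise : ‖yδ - act X w‖ ≤ δ) {t : ℕ} (ht : 1 ≤ t) :
    ‖iterate X k α yδ v₀ t - w‖ ≤ 4 * (opNorm X)⁻¹ * t * δ +
      2 * opNorm X * ‖v₀ + q‖ / α * (t : ℝ)⁻¹ := by
  have hδ : 0 ≤ δ := (norm_nonneg _).trans hnoise
  have ht' : (1 : ℝ) ≤ t := by exact_mod_cast ht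
  have hθ : (t : ℝ) / 2 ≤ theta t := by linarith [theta_lower t]
  have hθ' : theta t ≤ 2 * t := by linarith [theta_upper t]
  refine (hq.norm_iterate_sub_le hk hα0 hα1 hX hnoise t).trans ?_
  rw [add_comm]
  refine add_le_add ?_ ?_
  · calc 2 * δ * theta t / opNorm X ≤ 2 * δ * (2 * t) / opNorm X := by gcongr
      _ = 4 * (opNorm X)⁻¹ * t * δ := by field_simp; ring
  · calc opNorm X * ‖v₀ + q‖ / (α * theta t) ≤ opNorm X * ‖v₀ + q‖ / (α * (t / 2)) := by gcongr
      _ = 2 * opNorm X * ‖v₀ + q‖ / α * (t : ℝ)⁻¹ := by field_simp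

end Convergence

/-- The bound `a t δ + b / t` at `t = ⌈c δ^{-1/2}⌉`. -/
theorem early_stopping_le {a b c δ : ℝ} (ha : 0 ≤ a) (hb : 0 ≤ b) (hc : 0 < c) (hδ0 : 0 < δ)
    (hδ1 : δ ≤ 1) :
    a * (⌈c * δ ^ (-(1 / 2 : ℝ))⌉₊ : ℝ) * δ + b * (⌈c * δ ^ (-(1 / 2 : ℝ))⌉₊ : ℝ)⁻¹ ≤
      (a * (c + 1) + b * c⁻¹) * δ ^ (1 / 2 : ℝ) := by
  rw [Real.rpow_neg hδ0.le]
  set r := δ ^ (1 / 2 : ℝ) with hr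
  have hr0 : 0 < r := Real.rpow_pos_of_pos hδ0 _
  have hr1 : r ≤ 1 := Real.rpow_le_one hδ0.le hδ1 (by norm_num)
  have hδr : δ = r * r := by
    rw [hr, ← Real.rpow_add hδ0]
    norm_num
  have hcr : 0 < c * r⁻¹ := by positivity
  have hup : (⌈c * r⁻¹⌉₊ : ℝ) ≤ c * r⁻¹ + 1 := (Nat.ceil_lt_add_one hcr.le).le
  have hlow : c * r⁻¹ ≤ (⌈c * r⁻¹⌉₊ : ℝ) := Nat.le_ceil _
  have h1 : a * (⌈c * r⁻¹⌉₊ : ℝ) * δ ≤ a * (c + 1) * r := by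
    calc a * (⌈c * r⁻¹⌉₊ : ℝ) * δ ≤ a * (c * r⁻¹ + 1) * δ := by gcongr
      _ = a * (c + r) * r := by rw [hδr]; field_simp
      -- Here `δ ≤ 1` enters, through `r ≤ 1`: it absorbs the rounding of the ceiling.
      _ ≤ a * (c + 1) * r := by gcongr
  have h2 : b * (⌈c * r⁻¹⌉₊ : ℝ)⁻¹ ≤ b * c⁻¹ * r := by
    calc b * (⌈c * r⁻¹⌉₊ : ℝ)⁻¹ ≤ b * (c * r⁻¹)⁻¹ := by gcongr
      _ = b * c⁻¹ * r := by field_simp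
  linarith

end IRKSN

theorem theorem1 {n d : ℕ} (X : Matrix (Fin n) (Fin d) ℝ)
    (w : EuclideanSpace ℝ (Fin d)) (y yδ v₀ : EuclideanSpace ℝ (Fin n))
    (k : ℕ) (hk : 1 ≤ k) (S : Finset (Fin d)) (α δ : ℝ)
    -- noise level
    (hδ0 : 0 < δ) (hδ1 : δ ≤ 1) (hnoise : ‖yδ - y‖ ≤ δ)
    -- `w` is `k`-sparse with support `S`, solves `X w = y`, and `w_S` is the solution of
    -- `X_S z = y` of least Euclidean norm
    (hcard : S.card = k) (hS : ∀ i, i ∈ S ↔ w i ≠ 0)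
    (hsol : IRKSN.act X w = y)
    (hmin : ∀ z : EuclideanSpace ℝ S, IRKSN.act (IRKSN.colsOn X S) z = y →
      ‖IRKSN.restr S w‖ ≤ ‖z‖)
    -- `max_{ℓ ∉ S} |⟨X_S† x_ℓ, w_S⟩| < min_{j ∈ S} |⟨X_S† x_j, w_S⟩|`
    (hgap : ∀ l, l ∉ S → ∀ j ∈ S,
      |inner ℝ (IRKSN.act (IRKSN.pinv (IRKSN.colsOn X S)) (IRKSN.column X l))
        (IRKSN.restr S w)| <
      |inner ℝ (IRKSN.act (IRKSN.pinv (IRKSN.colsOn X S)) (IRKSN.column X j))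
        (IRKSN.restr S w)|)
    -- `0 < α < 1` and `α < η / ‖w‖_∞`, with
    -- `η = min_{j ∈ S} |⟨(X_S X_Sᵀ)† y, x_j⟩| - max_{ℓ ∉ S} |⟨(X_S X_Sᵀ)† y, x_ℓ⟩|`
    (hα0 : 0 < α) (hα1 : α < 1)
    (hα : ∀ l, l ∉ S → ∀ j ∈ S, α <
      (|inner ℝ (IRKSN.act (IRKSN.pinv (IRKSN.colsOn X S * (IRKSN.colsOn X S).transpose)) y)
          (IRKSN.column X j)| -
        |inner ℝ (IRKSN.act (IRKSN.pinv (IRKSN.colsOn X S * (IRKSN.colsOn X S).transpose)) y)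
          (IRKSN.column X l)|) / IRKSN.linftyNorm w)
    -- the constants
    (a b : ℝ) (ha : a = 4 * (IRKSN.opNorm X)⁻¹)
    (hb : b = 2 * IRKSN.opNorm X *
      ‖v₀ + IRKSN.act (IRKSN.pinv (IRKSN.colsOn X S).transpose) (IRKSN.restr S w)‖ / α) :
    (∀ t : ℕ, 2 ≤ t →
      ‖IRKSN.iterate X k α yδ v₀ t - w‖ ≤ a * t * δ + b * (t : ℝ)⁻¹) ∧
    (∀ c : ℝ, 0 < c →
      ‖IRKSN.iterate X k α yδ v₀ ⌈c * δ ^ (-(1 / 2 : ℝ))⌉₊ - w‖ ≤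
        (a * (c + 1) + b * c⁻¹) * δ ^ (1 / 2 : ℝ)) := by
  have hcert := IRKSN.isDualCertificate_pinv hk hcard hS hsol hmin hα0 hα1 hα
  have hX : 0 < IRKSN.opNorm X := IRKSN.opNorm_pos_of_least_norm
    (Finset.card_pos.1 (by omega)) (fun i hi => (hS i).1 hi) hsol hmin
  subst hsol
  -- Proved from `t = 1` on, since `⌈c δ^{-1/2}⌉` can equal `1`.
  have hbound : ∀ t : ℕ, 1 ≤ t →
      ‖IRKSN.iterate X k α yδ v₀ t - w‖ ≤ a * t * δ + b * (t : ℝ)⁻¹ := fun t ht => by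
    rw [ha, hb]
    exact hcert.norm_iterate_sub_le_of_pos hk hα0 hα1.le hX hnoise ht
  have ha0 : 0 ≤ a := by rw [ha]; positivity
  have hb0 : 0 ≤ b := by rw [hb]; positivity
  refine ⟨fun t ht => hbound t (by omega), fun c hc => ?_⟩
  exact (hbound _ (Nat.ceil_pos.2 (mul_pos hc (Real.rpow_pos_of_pos hδ0 _)))).trans
    (IRKSN.early_stopping_le ha0 hb0 hc hδ0 hδ1)
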